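/- Let $\xi=(\xi_t)_{t\ge 0}$ be a subordinator (a Lévy process started at $0$ with a.s. càdlàg paths and values in $[0,\infty)$), let $\kappa\ge 0$, and let $\mathbf e_\kappa$ be an independent exponential random variable of parameter $\kappa$ ($\mathbf e_0=\infty$ a.s.). The Laplace exponent $\phi$ of $\xi$ killed at rate $\kappa$ is given by $$\mathbb E\big[e^{-u\xi_t}\mathbf 1_{\{t<\mathbf e_\kappa\}}\big]=e^{-t\phi(u)},\qquad u,t\ge 0,$$ so that $\phi(0)=\kappa$, and its exponential functional is $$I_\phi=\int_0^{\mathbf e_\kappa}e^{-\xi_s}\,ds ,$$ whose law is denoted by $f_\phi(dx)$. Assume that $\phi$ is not identically zero on $[0,\infty)$. For $\beta\ge 0$ put $$\mathcal T_\beta\phi(u)=\frac{u}{u+\beta}\,\phi(u+\beta),\quad u\ge 0,$$ where $\mathcal T_0\phi=\phi$. Then for all $\kappa,\beta\ge 0$ one has $0<I_\phi<\infty$ almost surely, $0<\mathbb E[I_\phi^\beta]<\infty$, and the law $f_{\mathcal T_\beta\phi}$ of the exponential functional of any (possibly killed) subordinator with Laplace exponent $\mathcal T_\beta\phi$ is $$f_{\mathcal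 T_\beta\phi}(dx)=\frac{x^\beta f_\phi(dx)}{\mathbb E[I_\phi^\beta]},\qquad x>0 .$$ -/

import Mathlib

open MeasureTheory ProbabilityTheory Filter Topology
open scoped NNReal ENNReal

/-- `ξ` is a subordinator under `P` (a Lévy process with non-negative values), and `ζ` is an
independent killing time, exponentially distributed with parameter `κ`, where `ζ = ∞` almost surely
if `κ = 0`.  The killed subordinator is the process `ξ` considered on the time interval `[0, ζ)`. -/
structure IsKilledSubordinator {Ω : Type*} [MeasurableSpace Ω] (κ : ℝ≥0) (ξ : ℝ≥0 → Ω → ℝ)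
    (ζ : Ω → ℝ≥0∞) (P : Measure Ω) : Prop where
  measurable : ∀ t, Measurable (ξ t)
  start_zero : ∀ᵐ ω ∂P, ξ 0 ω = 0
  nonneg : ∀ᵐ ω ∂P, ∀ t, 0 ≤ ξ t ω
  /-- Almost surely the paths are right-continuous with left limits. -/
  cadlag : ∀ᵐ ω ∂P, ∀ t, ContinuousWithinAt (fun s => ξ s ω) (Set.Ici t) t ∧
    ∃ l, Tendsto (fun s => ξ s ω) (𝓝[<] t) (𝓝 l)
  indep_increments : HasIndepIncrements ξ P
  stationary_increments : ∀ s t, IdentDistrib (fun ω => ξ (s + t) ω - ξ s ω) (ξ t) P P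
  measurable_killing : Measurable ζ
  indep_killing : IndepFun ζ (fun ω t => ξ t ω) P
  law_killing : ∀ t : ℝ≥0, P {ω | (t : ℝ≥0∞) < ζ ω} = ENNReal.ofReal (Real.exp (-(κ * t)))

/-- `φ` is, on `[0, ∞)`, the Laplace exponent of the process `ξ` killed at time `ζ`:
`𝔼[exp (-u ξ_t) ; t < ζ] = exp (-t φ(u))`.  In particular `φ(0)` is the killing rate. -/
def IsLaplaceExponent {Ω : Type*} [MeasurableSpace Ω] (φ : ℝ → ℝ) (ξ : ℝ≥0 → Ω → ℝ)
    (ζ : Ω → ℝ≥0∞) (P : Measure Ω) : Prop :=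
  ∀ u : ℝ, 0 ≤ u → ∀ t : ℝ≥0,
    ∫ ω in {ω | (t : ℝ≥0∞) < ζ ω}, Real.exp (-(u * ξ t ω)) ∂P = Real.exp (-(t * φ u))

/-- The exponential functional `∫_0^ζ exp (-ξ_s) ds`, as a random variable with values in
`[0, ∞]`. -/
noncomputable def expFunctional {Ω : Type*} (ξ : ℝ≥0 → Ω → ℝ) (ζ : Ω → ℝ≥0∞) (ω : Ω) : ℝ≥0∞ :=
  ∫⁻ s in {s : ℝ | 0 ≤ s ∧ ENNReal.ofReal s < ζ ω}, ENNReal.ofReal (Real.exp (-ξ s.toNNReal ω))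

/-- The transformation `T_β φ (u) = u / (u + β) * φ (u + β)`, where `T_0` is the identity
(the division convention `0 / 0 = 0` is not used at `u = β = 0`). -/
noncomputable def transformT (β : ℝ) (φ : ℝ → ℝ) (u : ℝ) : ℝ :=
  if β = 0 then φ u else u / (u + β) * φ (u + β)

/-! The law of `I = I_φ` is determined by its integer moments, and both sides of the claim have the
same ones. For a path, `A_t = ∫_t^ζ exp(-ξ_u) du` has right derivative `-exp(-ξ_t)` before killing,
so `A_0 ^ s = s ∫ exp(-ξ_t) A_t ^ (s-1) dt` for `s ≥ 1` (`lintegral_Ici_rpow_eq`). By the Markov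
property at time `t`, with the lack of memory of `ζ`, `A_t` is `exp(-ξ_t)` times a copy of `I`
independent of `ξ_t` on `{t < ζ}`. The integrand thus has mean `exp(-t φ(s)) 𝔼[I ^ (s-1)]`, and
integrating over `t` gives the recursion `𝔼[I ^ s] = s / φ(s) * 𝔼[I ^ (s-1)]`.

Let `J` be the functional for `T_β φ`. As `n / T_β φ(n) = (n+β) / φ(n+β)`, the sequences `𝔼[J ^ n]`
and `𝔼[I ^ (β+n)] / 𝔼[I ^ β]` satisfy the same recursion and both start at `1`. The second consists
of the moments of the size-biased law of `I`. Since a Laplace exponent is nondecreasing, the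
recursion also bounds the `n`-th moment by `n! * c ^ n` with `c = 1 / φ(1)`. This gives exponential
moments, and then analyticity of the complex moment generating function makes the moments determine
the law (`ext_of_lintegral_pow_eq`). -/

/-! ### Moment determinacy under factorial bounds. -/

theorem ofReal_exp_eq_tsum {x : ℝ} (hx : 0 ≤ x) :
    ENNReal.ofReal (Real.exp x) = ∑' n : ℕ, ENNReal.ofReal (x ^ n / n.factorial) := by
  rw [Real.exp_eq_exp_ℝ, NormedSpace.exp_eq_tsum_div,
    ENNReal.ofReal_tsum_of_nonneg (fun n => by positivity)
      (NormedSpace.expSeries_div_summable (𝔸 := ℝ) x)]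

/-- Moment bounds of order `n! * c ^ n` for a nonnegative variable give exponential moments. -/
theorem integrable_exp_of_lintegral_pow_le {Ω : Type*} [MeasurableSpace Ω] {μ : Measure Ω}
    {X : Ω → ℝ} (hX : AEMeasurable X μ) (hX0 : ∀ᵐ ω ∂μ, 0 ≤ X ω) {c : ℝ} (hc : 0 ≤ c)
    (h : ∀ n : ℕ, ∫⁻ ω, ENNReal.ofReal (X ω ^ n) ∂μ ≤ ENNReal.ofReal (n.factorial * c ^ n))
    {r : ℝ} (hr : 0 ≤ r) (hrc : r * c < 1) :
    Integrable (fun ω => Real.exp (r * X ω)) μ := by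
  refine ⟨(by fun_prop : AEMeasurable _ μ).aestronglyMeasurable, ?_⟩
  rw [hasFiniteIntegral_iff_ofReal (ae_of_all _ fun _ => (Real.exp_pos _).le)]
  have key : ∀ n : ℕ, ∫⁻ ω, ENNReal.ofReal ((r * X ω) ^ n / n.factorial) ∂μ
      ≤ ENNReal.ofReal ((r * c) ^ n) := by
    intro n
    have : ∀ ω, ENNReal.ofReal ((r * X ω) ^ n / n.factorial)
        = ENNReal.ofReal (r ^ n / n.factorial) * ENNReal.ofReal (X ω ^ n) := by
      intro ω
      rw [← ENNReal.ofReal_mul (by positivity)]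
      congr 1
      ring
    simp_rw [this]
    rw [lintegral_const_mul' _ _ ENNReal.ofReal_ne_top]
    refine (mul_le_mul_right (h n) _).trans ?_
    rw [← ENNReal.ofReal_mul (by positivity)]
    apply le_of_eq
    congr 1
    have : (n.factorial : ℝ) ≠ 0 := by positivity
    rw [mul_pow]
    field_simp
  calc ∫⁻ ω, ENNReal.ofReal (Real.exp (r * X ω)) ∂μ
      = ∫⁻ ω, ∑' n : ℕ, ENNReal.ofReal ((r * X ω) ^ n / n.factorial) ∂μ := by
        refine lintegral_congr_ae ?_
        filter_upwards [hX0] with ω hω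
        exact ofReal_exp_eq_tsum (mul_nonneg hr hω)
    _ = ∑' n : ℕ, ∫⁻ ω, ENNReal.ofReal ((r * X ω) ^ n / n.factorial) ∂μ :=
        lintegral_tsum fun n => by fun_prop
    _ ≤ ∑' n : ℕ, ENNReal.ofReal ((r * c) ^ n) := ENNReal.tsum_le_tsum key
    _ = ENNReal.ofReal (∑' n : ℕ, (r * c) ^ n) :=
        (ENNReal.ofReal_tsum_of_nonneg (fun n => by positivity)
          (summable_geometric_of_lt_one (by positivity) hrc)).symm
    _ < ∞ := ENNReal.ofReal_lt_top

/-- Since `X ≥ 0`, `exp (r X)` dominates `exp (t X)` for every `t < r`, negative `t` included. -/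
theorem zero_mem_interior_integrableExpSet {Ω : Type*} [MeasurableSpace Ω] {μ : Measure Ω}
    [IsFiniteMeasure μ] {X : Ω → ℝ} (hX : AEMeasurable X μ) (hX0 : ∀ᵐ ω ∂μ, 0 ≤ X ω)
    {r : ℝ} (hr : 0 < r) (h : Integrable (fun ω => Real.exp (r * X ω)) μ) :
    0 ∈ interior (integrableExpSet X μ) := by
  rw [mem_interior_iff_mem_nhds]
  refine mem_of_superset (Iio_mem_nhds hr) fun t (ht : t < r) => ?_
  refine h.mono' (by fun_prop : AEMeasurable _ μ).aestronglyMeasurable ?_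
  filter_upwards [hX0] with ω hω
  rw [Real.norm_eq_abs, abs_of_pos (Real.exp_pos _)]
  exact Real.exp_le_exp.2 (mul_le_mul_of_nonneg_right ht.le hω)

/-- Two measures with exponential moments near `0` and the same moments are equal. -/
theorem ext_of_integral_pow_eq {μ ν : Measure ℝ} [IsFiniteMeasure μ] [IsFiniteMeasure ν]
    (hμ : 0 ∈ interior (integrableExpSet id μ)) (hν : 0 ∈ interior (integrableExpSet id ν))
    (h : ∀ n : ℕ, ∫ x, x ^ n ∂μ = ∫ x, x ^ n ∂ν) : μ = ν := by
  set S : Set ℝ := interior (integrableExpSet id μ) ∩ interior (integrableExpSet id ν) with hS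
  have hSc : Convex ℝ S := convex_integrableExpSet.interior.inter convex_integrableExpSet.interior
  have hAμ : AnalyticOnNhd ℂ (complexMGF id μ) {z | z.re ∈ S} :=
    fun z hz => analyticAt_complexMGF hz.1
  have hAν : AnalyticOnNhd ℂ (complexMGF id ν) {z | z.re ∈ S} :=
    fun z hz => analyticAt_complexMGF hz.2
  have hd : ∀ n, iteratedDeriv n (complexMGF id μ) 0 = iteratedDeriv n (complexMGF id ν) 0 := by
    intro n
    rw [iteratedDeriv_complexMGF (by simpa using hμ), iteratedDeriv_complexMGF (by simpa using hν)]
    have := h n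
    simp only [id, zero_mul, Complex.exp_zero, mul_one, ← Complex.ofReal_pow]
    rw [integral_complex_ofReal, integral_complex_ofReal, this]
  have h0 : (0 : ℂ) ∈ {z : ℂ | z.re ∈ S} := by simpa using ⟨hμ, hν⟩
  -- Equal moments are equal Taylor coefficients at `0`. The identity theorem then extends the
  -- equality to the vertical strip over `S`, which contains the imaginary axis, where one reads off
  -- the characteristic functions.
  have hev : complexMGF id μ =ᶠ[𝓝 0] complexMGF id ν := by
    have h1 := (hAμ 0 h0).hasFPowerSeriesAt
    have h2 := (hAν 0 h0).hasFPowerSeriesAt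
    simp_rw [hd] at h1
    have := h1.sub h2
    simp only [sub_self] at this
    filter_upwards [this.eventually_eq_zero] with z hz
    exact sub_eq_zero.1 hz
  have heq := hAμ.eqOn_of_preconnected_of_eventuallyEq hAν
    (hSc.linear_preimage Complex.reLm).isPreconnected h0 hev
  refine Measure.ext_of_charFun ?_
  ext t
  rw [← complexMGF_id_mul_I, ← complexMGF_id_mul_I]
  exact heq (by simpa using ⟨hμ, hν⟩)

/-- Probability measures on `[0, ∞]` with the same moments `m n ≤ n! * c ^ n` are equal. -/
theorem ext_of_lintegral_pow_eq {μ ν : Measure ℝ≥0∞} [IsProbabilityMeasure μ]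
    [IsProbabilityMeasure ν] (h : ∀ n : ℕ, ∫⁻ x, x ^ n ∂μ = ∫⁻ x, x ^ n ∂ν) {c : ℝ} (hc : 0 ≤ c)
    (hle : ∀ n : ℕ, ∫⁻ x, x ^ n ∂μ ≤ ENNReal.ofReal (n.factorial * c ^ n)) : μ = ν := by
  have fin : ∀ ρ : Measure ℝ≥0∞, (∀ n : ℕ, ∫⁻ x, x ^ n ∂ρ ≤ ENNReal.ofReal (n.factorial * c ^ n)) →
      ∀ᵐ x ∂ρ, x ≠ ∞ := by
    intro ρ hρ
    have h1 := hρ 1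
    simp only [pow_one] at h1
    filter_upwards [ae_lt_top measurable_id (h1.trans_lt ENNReal.ofReal_lt_top).ne] with x hx
    exact hx.ne
  have pw : ∀ ρ : Measure ℝ≥0∞, (∀ n : ℕ, ∫⁻ x, x ^ n ∂ρ ≤ ENNReal.ofReal (n.factorial * c ^ n)) →
      ∀ n : ℕ, ∫⁻ x, ENNReal.ofReal (x ^ n) ∂(ρ.map ENNReal.toReal) = ∫⁻ x, x ^ n ∂ρ := by
    intro ρ hρ n
    rw [lintegral_map (by fun_prop) ENNReal.measurable_toReal]
    refine lintegral_congr_ae ?_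
    filter_upwards [fin ρ hρ] with x hx
    rw [ENNReal.ofReal_pow ENNReal.toReal_nonneg, ENNReal.ofReal_toReal hx]
  have pos : ∀ ρ : Measure ℝ≥0∞, ∀ᵐ x ∂(ρ.map ENNReal.toReal), 0 ≤ x := fun ρ =>
    (ae_map_iff ENNReal.measurable_toReal.aemeasurable measurableSet_Ici).2
      (ae_of_all _ fun x => ENNReal.toReal_nonneg)
  have int : ∀ ρ : Measure ℝ≥0∞, IsProbabilityMeasure ρ →
      (∀ n : ℕ, ∫⁻ x, x ^ n ∂ρ ≤ ENNReal.ofReal (n.factorial * c ^ n)) →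
      0 ∈ interior (integrableExpSet id (ρ.map ENNReal.toReal)) := by
    intro ρ _ hρ
    -- The `+ 1` keeps `r` defined when `c = 0` and makes `r * c < 1`.
    have hr : (0 : ℝ) < 1 / (c + 1) := by positivity
    have : IsProbabilityMeasure (ρ.map ENNReal.toReal) :=
      Measure.isProbabilityMeasure_map ENNReal.measurable_toReal.aemeasurable
    refine zero_mem_interior_integrableExpSet aemeasurable_id (pos ρ) hr
      (integrable_exp_of_lintegral_pow_le aemeasurable_id (pos ρ) hc (fun n => ?_) hr.le ?_)
    · exact (pw ρ hρ n).le.trans (hρ n)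
    · rw [div_mul_eq_mul_div, one_mul, div_lt_one (by positivity)]
      linarith
  have hle' : ∀ n : ℕ, ∫⁻ x, x ^ n ∂ν ≤ ENNReal.ofReal (n.factorial * c ^ n) :=
    fun n => h n ▸ hle n
  have hm : μ.map ENNReal.toReal = ν.map ENNReal.toReal := by
    refine ext_of_integral_pow_eq (int μ ‹_› hle) (int ν ‹_› hle') fun n => ?_
    rw [integral_eq_lintegral_of_nonneg_ae, integral_eq_lintegral_of_nonneg_ae, pw μ hle, pw ν hle',
      h n]
    · filter_upwards [pos ν] with x hx using pow_nonneg hx n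
    · fun_prop
    · filter_upwards [pos μ] with x hx using pow_nonneg hx n
    · fun_prop
  have back : ∀ ρ : Measure ℝ≥0∞, (∀ᵐ x ∂ρ, x ≠ ∞) →
      (ρ.map ENNReal.toReal).map ENNReal.ofReal = ρ := by
    intro ρ hρ
    rw [Measure.map_map ENNReal.measurable_ofReal ENNReal.measurable_toReal]
    conv_rhs => rw [← Measure.map_id (μ := ρ)]
    refine Measure.map_congr ?_
    filter_upwards [hρ] with x hx
    simp [hx]
  rw [← back μ (fin μ hle), hm, back ν (fin ν hle')]

/-! ### A pathwise fundamental theorem of calculus for powers. -/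

/-- The integral of a nonnegative right-continuous function raised to a power `s ≥ 1`. -/
theorem lintegral_Ici_rpow_eq {f : ℝ → ℝ≥0∞} (hm : Measurable f) (hf : ∀ t, f t ≠ ∞)
    (hrc : ∀ t, 0 ≤ t → ContinuousWithinAt f (Set.Ici t) t)
    (hfin : ∫⁻ t in Set.Ici 0, f t ≠ ∞) {s : ℝ} (hs : 1 ≤ s) :
    (∫⁻ t in Set.Ici 0, f t) ^ s =
      ENNReal.ofReal s * ∫⁻ t in Set.Ici 0, f t * (∫⁻ u in Set.Ici t, f u) ^ (s - 1) := by
  set g : ℝ → ℝ := fun t => (f t).toReal with hg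
  have hgm : Measurable g := hm.ennreal_toReal
  have hfg : ∀ t, f t = ENNReal.ofReal (g t) := fun t => (ENNReal.ofReal_toReal (hf t)).symm
  have hg0 : ∀ t, 0 ≤ g t := fun t => ENNReal.toReal_nonneg
  have hint : IntegrableOn g (Set.Ici 0) := by
    refine integrable_toReal_of_lintegral_ne_top hm.aemeasurable hfin
  have hint' : ∀ {t : ℝ}, 0 ≤ t → IntegrableOn g (Set.Ici t) := fun ht =>
    hint.mono_set (Set.Ici_subset_Ici.2 ht)
  -- The tail integral for `t ≥ 0`, written through a primitive so that it can be differentiated.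
  set A : ℝ → ℝ := fun t => (∫ u in Set.Ici 0, g u) - ∫ u in (0:ℝ)..t, g u with hA
  have hii : ∀ {t : ℝ}, 0 ≤ t → IntervalIntegrable g volume 0 t := fun ht =>
    (intervalIntegrable_iff_integrableOn_Icc_of_le ht).2 (hint.mono_set Set.Icc_subset_Ici_self)
  have hAeq : ∀ {t : ℝ}, 0 ≤ t → A t = ∫ u in Set.Ici t, g u := by
    intro t ht
    rw [hA]
    simp only
    rw [integral_Ici_eq_integral_Ioi, integral_Ici_eq_integral_Ioi,
      ← intervalIntegral.integral_interval_add_Ioi (hint.mono_set Set.Ioi_subset_Ici_self)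
        ((hint' ht).mono_set Set.Ioi_subset_Ici_self)]
    ring
  have hAl : ∀ {t : ℝ}, 0 ≤ t → ∫⁻ u in Set.Ici t, f u = ENNReal.ofReal (A t) := by
    intro t ht
    rw [hAeq ht, ofReal_integral_eq_lintegral_ofReal (hint' ht) (ae_of_all _ hg0)]
    simp_rw [hfg]
  have hA0 : ∀ {t : ℝ}, 0 ≤ t → 0 ≤ A t := fun ht => by
    rw [hAeq ht]; exact integral_nonneg hg0
  have hAcont : ContinuousOn A (Set.Ici 0) := by
    have hG : Integrable ((Set.Ici 0).indicator g) :=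
      (integrable_indicator_iff measurableSet_Ici).2 hint
    refine ContinuousOn.congr ((continuous_const (y := ∫ u in Set.Ici 0, g u)).sub
      (intervalIntegral.continuous_primitive
      (fun a b => hG.intervalIntegrable) 0)).continuousOn fun t ht => ?_
    simp only [hA]
    congr 1
    refine intervalIntegral.integral_congr fun u hu => ?_
    rw [Set.uIcc_of_le ht] at hu
    exact (Set.indicator_of_mem (Set.mem_Ici.2 hu.1) g).symm
  have hAle : ∀ {t : ℝ}, 0 ≤ t → A t ≤ A 0 := by
    intro t ht
    rw [hAeq ht, hAeq le_rfl]
    exact setIntegral_mono_set hint (ae_of_all _ hg0)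
      (Set.Ici_subset_Ici.2 ht).eventuallyLE
  -- Only right continuity of `f` is available, so only a right derivative; with continuity of `A`
  -- this suffices for the fundamental theorem.
  have hAd : ∀ {t : ℝ}, 0 ≤ t → HasDerivWithinAt A (-g t) (Set.Ioi t) t := by
    intro t ht
    have := intervalIntegral.integral_hasDerivWithinAt_right (hii ht)
      (s := Set.Ici t) (t := Set.Ioi t) (hgm.stronglyMeasurable.stronglyMeasurableAtFilter)
      (((ENNReal.tendsto_toReal (hf t)).comp (hrc t ht)).mono_left
        (nhdsWithin_mono _ Set.Ioi_subset_Ici_self))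
    exact (this.const_sub _).mono Set.Ioi_subset_Ici_self
  have hAlim : Tendsto A atTop (𝓝 0) := by
    have := intervalIntegral_tendsto_integral_Ioi 0 (hint.mono_set Set.Ioi_subset_Ici_self)
      tendsto_id
    have := (tendsto_const_nhds (x := ∫ u in Set.Ici 0, g u)).sub this
    rw [integral_Ici_eq_integral_Ioi, sub_self] at this
    simpa only [hA, integral_Ici_eq_integral_Ioi, id] using this
  have hs0 : 0 < s := by linarith
  set h : ℝ → ℝ := fun t => s * (g t * A t ^ (s - 1)) with hh
  have hAm : AEStronglyMeasurable (fun t => A t ^ (s - 1)) (volume.restrict (Set.Ici 0)) := by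
    refine ContinuousOn.aestronglyMeasurable ?_ measurableSet_Ici
    exact hAcont.rpow_const fun x hx => Or.inr (by linarith)
  have hhint : IntegrableOn h (Set.Ici 0) := by
    refine Integrable.const_mul (Integrable.mono' (hint.mul_const (A 0 ^ (s - 1)))
      (hgm.aestronglyMeasurable.mul hAm) ?_) s
    refine (ae_restrict_iff' measurableSet_Ici).2 (ae_of_all _ fun t ht => ?_)
    rw [Pi.mul_apply, Real.norm_eq_abs, abs_of_nonneg (mul_nonneg (hg0 t) (Real.rpow_nonneg (hA0 ht) _))]
    exact mul_le_mul_of_nonneg_left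
      (Real.rpow_le_rpow (hA0 ht) (hAle ht) (by linarith)) (hg0 t)
  have hftc : ∀ {T : ℝ}, 0 ≤ T → ∫ t in (0:ℝ)..T, h t = A 0 ^ s - A T ^ s := by
    intro T hT
    have := intervalIntegral.integral_eq_sub_of_hasDeriv_right_of_le (f := fun t => -(A t ^ s))
      (f' := h) hT
      ((hAcont.mono Set.Icc_subset_Ici_self).rpow_const fun x hx => Or.inr hs0.le).neg
      (fun t ht => ?_) ((intervalIntegrable_iff_integrableOn_Icc_of_le hT).2
        (hhint.mono_set Set.Icc_subset_Ici_self))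
    · rw [this]; ring
    -- `A t` may vanish, so the chain rule for the power rests on `1 ≤ s`.
    · convert! ((hAd ht.1.le).rpow_const (Or.inr hs)).neg using 1
      simp only [hh]; ring
  have hlim : ∫ t in Set.Ici 0, h t = A 0 ^ s := by
    rw [integral_Ici_eq_integral_Ioi]
    refine tendsto_nhds_unique (intervalIntegral_tendsto_integral_Ioi 0
      (hhint.mono_set Set.Ioi_subset_Ici_self) tendsto_id) ?_
    have h1 : Tendsto (fun T => A 0 ^ s - A T ^ s) atTop (𝓝 (A 0 ^ s - 0 ^ s)) :=
      tendsto_const_nhds.sub (hAlim.rpow_const (Or.inr hs0.le))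
    rw [Real.zero_rpow hs0.ne', sub_zero] at h1
    refine h1.congr' ?_
    filter_upwards [eventually_ge_atTop 0] with T hT using (hftc hT).symm
  rw [hAl le_rfl, ENNReal.ofReal_rpow_of_nonneg (hA0 le_rfl) hs0.le, ← hlim,
    ofReal_integral_eq_lintegral_ofReal hhint, ← lintegral_const_mul' _ _ ENNReal.ofReal_ne_top]
  · refine setLIntegral_congr_fun measurableSet_Ici fun t ht => ?_
    simp only [hh]
    rw [hAl ht, ENNReal.ofReal_rpow_of_nonneg (hA0 ht) (by linarith), hfg t,
      ← ENNReal.ofReal_mul (hg0 t), ← ENNReal.ofReal_mul hs0.le]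
  · refine (ae_restrict_iff' measurableSet_Ici).2 (ae_of_all _ fun t ht => ?_)
    exact mul_nonneg hs0.le (mul_nonneg (hg0 t) (Real.rpow_nonneg (hA0 ht) _))

/-! ### Lévy processes restarted at a fixed time. -/

/-- Independence of increments is used along monotone sequences of times. Starting the sequence at
`0` makes each shifted value at a time of `I` a partial sum of consecutive increments. -/
theorem Finset.exists_monotone_nat_enumeration (I : Finset ℝ≥0) :
    ∃ e : ℕ → ℝ≥0, Monotone e ∧ e 0 = 0 ∧ ∀ s ∈ I, ∃ k, e k = s := by
  suffices h : ∃ (e : ℕ → ℝ≥0) (N : ℕ), Monotone e ∧ e 0 = 0 ∧ (∀ n, e n ≤ I.sup id) ∧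
      ∀ s ∈ I, ∃ k ≤ N, e k = s by
    obtain ⟨e, N, h1, h2, -, h3⟩ := h
    exact ⟨e, h1, h2, fun s hs => (h3 s hs).imp fun k hk => hk.2⟩
  induction I using Finset.induction_on_max with
  | empty => exact ⟨fun _ => 0, 0, monotone_const, rfl, by simp, by simp⟩
  | insert a I ha ih =>
    obtain ⟨e, N, h1, h2, h3, h4⟩ := ih
    have hsup : I.sup id ≤ a := Finset.sup_le fun x hx => (ha x hx).le
    refine ⟨fun n => if n ≤ N then e n else a, N + 1, ?_, by simp [h2], ?_, ?_⟩
    · intro m n hmn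
      dsimp only
      split_ifs with hm hn hn
      · exact h1 hmn
      · exact (h3 m).trans hsup
      · omega
      · exact le_rfl
    · intro n
      rw [Finset.sup_insert, id, sup_of_le_left hsup]
      dsimp only
      split_ifs
      · exact (h3 n).trans hsup
      · exact le_rfl
    · intro s hs
      rcases Finset.mem_insert.1 hs with rfl | hs
      · exact ⟨N + 1, le_rfl, by simp⟩
      · obtain ⟨k, hk, rfl⟩ := h4 s hs
        exact ⟨k, by omega, by simp [hk]⟩

section Levy

theorem shift_eq_sum_increments {Ω : Type*} (X : ℝ≥0 → Ω → ℝ) {e : ℕ → ℝ≥0} (he : e 0 = 0) (t : ℝ≥0) (k : ℕ)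
    (ω : Ω) : X (t + e k) ω - X t ω
      = ∑ i ∈ Finset.range k, (X (t + e (i + 1)) ω - X (t + e i) ω) := by
  rw [Finset.sum_range_sub (fun i => X (t + e i) ω), he, add_zero]

variable {Ω : Type*} [MeasurableSpace Ω] {P : Measure Ω} {X : ℝ≥0 → Ω → ℝ}

/-- The increments of a Lévy process after time `t` have the law of the process. -/
theorem map_shift_eq_of_stationary [IsProbabilityMeasure P] (hm : ∀ t, Measurable (X t))
    (h0 : ∀ᵐ ω ∂P, X 0 ω = 0) (hind : HasIndepIncrements X P)
    (hst : ∀ s t, IdentDistrib (fun ω => X (s + t) ω - X s ω) (X t) P P) (t : ℝ≥0) :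
    P.map (fun ω s => X (t + s) ω - X t ω) = P.map (fun ω s => X s ω) := by
  -- The process itself is viewed as its shift by `0`, so that one computation with `t` arbitrary
  -- covers both sides.
  have hsh : P.map (fun ω s => X s ω) = P.map (fun ω s => X (0 + s) ω - X 0 ω) := by
    refine Measure.map_congr ?_
    filter_upwards [h0] with ω hω
    ext s
    simp [hω]
  rw [hsh, map_eq_iff_forall_finset_map_restrict_eq (X := fun s ω => X (t + s) ω - X t ω)
    (Y := fun s ω => X (0 + s) ω - X 0 ω)
    (measurable_pi_lambda _ fun s => (hm _).sub (hm _)).aemeasurable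
    (measurable_pi_lambda _ fun s => (hm _).sub (hm _)).aemeasurable]
  intro I
  obtain ⟨e, he, he0, hk⟩ := I.exists_monotone_nat_enumeration
  choose! k hk using hk
  let g : (ℕ → ℝ) → I → ℝ := fun d s => ∑ i ∈ Finset.range (k s), d i
  have hg : Measurable g := by fun_prop
  let D : ℝ≥0 → Ω → ℕ → ℝ := fun t ω i => X (t + e (i + 1)) ω - X (t + e i) ω
  have hD : ∀ t, Measurable (D t) := fun t => measurable_pi_lambda _ fun i => (hm _).sub (hm _)
  have hrep : ∀ t, (fun ω => I.restrict fun s => X (t + s) ω - X t ω) = g ∘ D t := by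
    intro t
    ext ω s
    have := shift_eq_sum_increments X he0 t (k s) ω
    rw [hk s s.2] at this
    exact this
  -- The consecutive increments have a product law in which `t` no longer appears.
  have hlaw : ∀ t, P.map (D t) = Measure.infinitePi fun i => P.map (X (e (i + 1) - e i)) := by
    intro t
    have h := hind.nat (t := fun i => t + e i) fun i j hij => by
      dsimp only; gcongr; exact he hij
    rw [h.map_fun_eq_infinitePi_map₀ (hD t).aemeasurable]
    congr 1
    ext1 i
    have := (hst (t + e i) (e (i + 1) - e i)).map_eq
    rwa [add_assoc, add_tsub_cancel_of_le (he (Nat.le_succ i))] at this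
  rw [hrep, hrep, ← Measure.map_map hg (hD _), ← Measure.map_map hg (hD _), hlaw, hlaw]

/-- The increments of a Lévy process after time `t` are independent of its value at time `t`. -/
theorem indepFun_shift_of_indepIncrements [IsProbabilityMeasure P] (hm : ∀ t, Measurable (X t))
    (h0 : ∀ᵐ ω ∂P, X 0 ω = 0) (hind : HasIndepIncrements X P) (t : ℝ≥0) :
    IndepFun (X t) (fun ω s => X (t + s) ω - X t ω) P := by
  refine IndepFun.indepFun_process (hm t) (fun s => (hm _).sub (hm _)) fun I => ?_
  obtain ⟨e, he, he0, hk⟩ := I.exists_monotone_nat_enumeration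
  choose! k hk using hk
  -- The times are `0, t, t + e 1, ...`: increment `0` is `X t - X 0`, and those with positive index
  -- determine the shifted process.
  let τ : ℕ → ℝ≥0 := fun n => n.casesOn 0 fun n => t + e n
  have hτ : Monotone τ := by
    refine monotone_nat_of_le_succ fun n => ?_
    cases n with
    | zero => exact zero_le
    | succ n => exact add_le_add_right (he (Nat.le_succ n)) t
  have h := hind.nat hτ
  set N := I.sup k
  let S : Finset ℕ := (Finset.range N).map ⟨Nat.succ, Nat.succ_injective⟩
  have hS : ∀ {i}, i < N → i + 1 ∈ S := fun hi =>
    Finset.mem_map.2 ⟨_, Finset.mem_range.2 hi, rfl⟩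
  have hdisj : Disjoint {0} S := by
    simp [S]
  have h2 := h.indepFun_finset {0} S hdisj fun i => (hm _).sub (hm _)
  -- The value `0` is never used: `k s ≤ N` puts every index `i + 1` of the sum in `S`.
  let g : (S → ℝ) → I → ℝ := fun d s =>
    ∑ i ∈ Finset.range (k s), if hi : i + 1 ∈ S then d ⟨i + 1, hi⟩ else 0
  have hg : Measurable g := by
    refine measurable_pi_lambda _ fun s => Finset.measurable_sum _ fun i _ => ?_
    split_ifs
    · exact measurable_pi_apply _
    · exact measurable_const
  have hφ : Measurable fun d : ({0} : Finset ℕ) → ℝ => d ⟨0, Finset.mem_singleton_self 0⟩ :=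
    measurable_pi_apply (⟨0, Finset.mem_singleton_self 0⟩ : ({0} : Finset ℕ))
  have h3 := h2.comp (φ := fun d : ({0} : Finset ℕ) → ℝ => d ⟨0, Finset.mem_singleton_self 0⟩)
    (ψ := g) hφ hg
  refine h3.congr ?_ (ae_of_all _ fun ω => ?_)
  · filter_upwards [h0] with ω hω
    simp [τ, he0, hω]
  · ext s
    have := shift_eq_sum_increments X he0 t (k s) ω
    rw [hk s s.2] at this
    refine Eq.trans ?_ this.symm
    refine Finset.sum_congr rfl fun i hi => ?_
    rw [dif_pos (hS ((Finset.mem_range.1 hi).trans_le (Finset.le_sup s.2)))]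

end Levy

/-! ### Lack of memory and the Markov property. -/

/-- The lack of memory of an exponential law on `[0, ∞]`. -/
theorem lintegral_memoryless {ν : Measure ℝ≥0∞} [IsProbabilityMeasure ν] {κ : ℝ≥0}
    (hν : ∀ t : ℝ≥0, ν {z | (t : ℝ≥0∞) < z} = ENNReal.ofReal (Real.exp (-(κ * t)))) (t : ℝ≥0)
    {g : ℝ≥0∞ → ℝ≥0∞} (hg : Measurable g) :
    ∫⁻ z in {z | (t : ℝ≥0∞) < z}, g (z - t) ∂ν
      = ENNReal.ofReal (Real.exp (-(κ * t))) * ∫⁻ z, g z ∂ν := by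
  have hsub : Measurable fun z : ℝ≥0∞ => z - t := by fun_prop
  -- Both finite measures are compared on the tails `(a, ∞]`: `z - t > a` amounts to `z > a + t`,
  -- and the exponents add.
  have key : (ν.restrict {z | (t : ℝ≥0∞) < z}).map (fun z => z - (t : ℝ≥0∞))
      = ENNReal.ofReal (Real.exp (-(κ * t))) • ν := by
    have : IsFiniteMeasure ((ν.restrict {z | (t : ℝ≥0∞) < z}).map fun z => z - (t : ℝ≥0∞)) :=
      Measure.isFiniteMeasure_map _ _
    have huniv : ((ν.restrict {z | (t : ℝ≥0∞) < z}).map fun z => z - (t : ℝ≥0∞)) Set.univ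
        = (ENNReal.ofReal (Real.exp (-(κ * t))) • ν) Set.univ := by
      rw [Measure.map_apply hsub MeasurableSet.univ]
      simp [hν]
    have hIoi : ∀ a : ℝ≥0∞, ((ν.restrict {z | (t : ℝ≥0∞) < z}).map fun z => z - (t : ℝ≥0∞)) (Set.Ioi a)
        = (ENNReal.ofReal (Real.exp (-(κ * t))) • ν) (Set.Ioi a) := by
      intro a
      induction a with
      | top => simp
      | coe a =>
        rw [Measure.map_apply hsub measurableSet_Ioi, Measure.restrict_apply
          (hsub measurableSet_Ioi)]
        have : ((fun z : ℝ≥0∞ => z - t) ⁻¹' Set.Ioi (a : ℝ≥0∞)) ∩ {z | (t : ℝ≥0∞) < z}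
            = {z | ((a + t : ℝ≥0) : ℝ≥0∞) < z} := by
          ext z
          simp only [Set.mem_inter_iff, Set.mem_preimage, Set.mem_Ioi, Set.mem_ofPred_eq,
            lt_tsub_iff_right, ENNReal.coe_add, and_iff_left_iff_imp]
          exact fun h => le_add_self.trans_lt h
        have h2 : Set.Ioi (a : ℝ≥0∞) = {z | (a : ℝ≥0∞) < z} := rfl
        rw [this, hν, Measure.smul_apply, h2, hν, smul_eq_mul, ← ENNReal.ofReal_mul (by positivity),
          ← Real.exp_add]
        congr 2
        push_cast
        ring
    refine Measure.ext_of_Iic _ _ fun a => ?_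
    have : Set.Iic a = (Set.Ioi a)ᶜ := by simp
    have hfin : IsFiniteMeasure (ENNReal.ofReal (Real.exp (-(κ * t))) • ν) :=
      Measure.smul_finite ν ENNReal.ofReal_ne_top
    rw [this, measure_compl measurableSet_Ioi (measure_ne_top _ _),
      measure_compl measurableSet_Ioi (measure_ne_top _ _), huniv, hIoi]
  rw [← lintegral_map (μ := ν.restrict _) hg hsub, key, lintegral_smul_measure, smul_eq_mul]

section Markov

variable {Ω : Type*} [MeasurableSpace Ω] {P : Measure Ω} {κ : ℝ≥0} {ξ : ℝ≥0 → Ω → ℝ}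
  {ζ : Ω → ℝ≥0∞}

/-- The simple Markov property of a killed subordinator at a fixed time. -/
theorem IsKilledSubordinator.lintegral_markov [IsProbabilityMeasure P]
    (h : IsKilledSubordinator κ ξ ζ P) (t : ℝ≥0) {f : ℝ → ℝ≥0∞} (hf : Measurable f)
    {G : (ℝ≥0 → ℝ) × ℝ≥0∞ → ℝ≥0∞} (hG : Measurable G) :
    ∫⁻ ω in {ω | (t : ℝ≥0∞) < ζ ω},
        f (ξ t ω) * G (fun s => ξ (t + s) ω - ξ t ω, ζ ω - t) ∂P
      = (∫⁻ ω in {ω | (t : ℝ≥0∞) < ζ ω}, f (ξ t ω) ∂P) *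
        ∫⁻ ω, G (fun s => ξ s ω, ζ ω) ∂P := by
  set sh : Ω → ℝ≥0 → ℝ := fun ω s => ξ (t + s) ω - ξ t ω with hsh
  set path : Ω → ℝ≥0 → ℝ := fun ω s => ξ s ω with hpath
  have hshm : Measurable sh := measurable_pi_lambda _ fun s => (h.measurable _).sub (h.measurable _)
  have hpm : Measurable path := measurable_pi_lambda _ h.measurable
  have hζ := h.measurable_killing
  have : IsProbabilityMeasure (P.map ζ) := Measure.isProbabilityMeasure_map hζ.aemeasurable
  have : IsProbabilityMeasure (P.map path) := Measure.isProbabilityMeasure_map hpm.aemeasurable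
  have : IsProbabilityMeasure (P.map (ξ t)) :=
    Measure.isProbabilityMeasure_map (h.measurable t).aemeasurable
  have hν : ∀ t : ℝ≥0, P.map ζ {z | (t : ℝ≥0∞) < z} = ENNReal.ofReal (Real.exp (-(κ * t))) :=
    fun t => (Measure.map_apply hζ measurableSet_Ioi).trans (h.law_killing t)
  have hφ : Measurable fun x : ℝ≥0 → ℝ => (x t, fun s => x (t + s) - x t) := by
    refine (measurable_pi_apply t).prodMk (measurable_pi_lambda _ fun s => ?_)
    exact (measurable_pi_apply _).sub (measurable_pi_apply _)
  have hlaw2 : P.map (fun ω => (ξ t ω, sh ω)) = (P.map (ξ t)).prod (P.map path) := by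
    rw [(indepFun_iff_map_prod_eq_prod_map_map (h.measurable t).aemeasurable hshm.aemeasurable).1
      (indepFun_shift_of_indepIncrements h.measurable h.start_zero h.indep_increments t),
      map_shift_eq_of_stationary h.measurable h.start_zero h.indep_increments
        h.stationary_increments t]
  have hpair : Measurable fun ω => (ξ t ω, sh ω) := (h.measurable t).prodMk hshm
  -- The killing time is independent of the whole path, hence of the pair in `hlaw2`; all three
  -- variables are jointly independent.
  have hlaw3 : P.map (fun ω => (ζ ω, (ξ t ω, sh ω)))
      = (P.map ζ).prod ((P.map (ξ t)).prod (P.map path)) := by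
    rw [(indepFun_iff_map_prod_eq_prod_map_map hζ.aemeasurable hpair.aemeasurable).1
      (h.indep_killing.comp measurable_id hφ), hlaw2]
  have hlaw4 : P.map (fun ω => (ζ ω, path ω)) = (P.map ζ).prod (P.map path) :=
    (indepFun_iff_map_prod_eq_prod_map_map hζ.aemeasurable hpm.aemeasurable).1 h.indep_killing
  have hset : MeasurableSet {z : ℝ≥0∞ | (t : ℝ≥0∞) < z} := measurableSet_Ioi
  have main : ∀ H : (ℝ≥0 → ℝ) × ℝ≥0∞ → ℝ≥0∞, Measurable H →
      ∫⁻ ω in {ω | (t : ℝ≥0∞) < ζ ω}, f (ξ t ω) * H (sh ω, ζ ω - t) ∂P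
        = ENNReal.ofReal (Real.exp (-(κ * t))) * (∫⁻ x, f x ∂(P.map (ξ t))) *
          ∫⁻ ω, H (path ω, ζ ω) ∂P := by
    intro H hH
    have hint : Measurable fun p : ℝ≥0∞ × ℝ × (ℝ≥0 → ℝ) =>
        {z : ℝ≥0∞ | (t : ℝ≥0∞) < z}.indicator 1 p.1 * (f p.2.1 * H (p.2.2, p.1 - t)) := by
      refine ((measurable_const.indicator hset).comp measurable_fst).mul
        ((hf.comp (measurable_fst.comp measurable_snd)).mul (hH.comp ?_))
      fun_prop
    calc ∫⁻ ω in {ω | (t : ℝ≥0∞) < ζ ω}, f (ξ t ω) * H (sh ω, ζ ω - t) ∂P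
        = ∫⁻ ω, {z : ℝ≥0∞ | (t : ℝ≥0∞) < z}.indicator 1 (ζ ω) *
            (f (ξ t ω) * H (sh ω, ζ ω - t)) ∂P := by
          rw [← lintegral_indicator (s := {ω | (t : ℝ≥0∞) < ζ ω}) (hζ hset)]
          refine lintegral_congr fun ω => ?_
          by_cases hω : (t : ℝ≥0∞) < ζ ω <;> simp [Set.indicator, hω]
      _ = ∫⁻ z, ∫⁻ q, {z : ℝ≥0∞ | (t : ℝ≥0∞) < z}.indicator 1 z * (f q.1 * H (q.2, z - t))
            ∂((P.map (ξ t)).prod (P.map path)) ∂(P.map ζ) := by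
          rw [← lintegral_prod _ hint.aemeasurable, ← hlaw3, lintegral_map hint (hζ.prodMk hpair)]
      _ = ∫⁻ z, {z : ℝ≥0∞ | (t : ℝ≥0∞) < z}.indicator
            (fun z => (∫⁻ x, f x ∂(P.map (ξ t))) * ∫⁻ x, H (x, z - t) ∂(P.map path)) z
            ∂(P.map ζ) := by
          refine lintegral_congr fun z => ?_
          by_cases hz : (t : ℝ≥0∞) < z
          · simp only [Set.indicator, Set.mem_ofPred_eq, hz, if_true, Pi.one_apply, one_mul]
            exact lintegral_prod_mul (g := fun x => H (x, z - t)) hf.aemeasurable (by fun_prop)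
          · simp [Set.indicator, hz]
      _ = (∫⁻ x, f x ∂(P.map (ξ t))) * ∫⁻ z in {z : ℝ≥0∞ | (t : ℝ≥0∞) < z},
            (fun z => ∫⁻ x, H (x, z) ∂(P.map path)) (z - t) ∂(P.map ζ) := by
          rw [lintegral_indicator hset, lintegral_const_mul]
          exact (Measurable.lintegral_prod_left' hH).comp (by fun_prop)
      _ = _ := by
          rw [lintegral_memoryless hν t (Measurable.lintegral_prod_left' hH)]
          have : ∫⁻ ω, H (path ω, ζ ω) ∂P
              = ∫⁻ z, ∫⁻ x, H (x, z) ∂(P.map path) ∂(P.map ζ) := by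
            have hH' : Measurable fun p : ℝ≥0∞ × (ℝ≥0 → ℝ) => H (p.2, p.1) := by fun_prop
            rw [← lintegral_prod (fun p : ℝ≥0∞ × (ℝ≥0 → ℝ) => H (p.2, p.1)) hH'.aemeasurable,
              ← hlaw4, lintegral_map hH' (hζ.prodMk hpm)]
          rw [this]
          ring
  -- The case `H = 1` identifies the constant in `main` as the integral of `f (ξ t)` over `{t < ζ}`.
  have h1 := main (fun _ => 1) measurable_const
  simp only [mul_one, lintegral_const, measure_univ] at h1
  rw [main G hG, h1]

end Markov

/-! ### Measurable path functionals. -/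

/-- A version of `exp (-x t)` that is jointly measurable in the path `x` and the time `t`, and is
correct for right-continuous paths. -/
noncomputable def expPath (x : ℝ≥0 → ℝ) (t : ℝ) : ℝ≥0∞ :=
  limsup (fun n : ℕ => ENNReal.ofReal
    (Real.exp (-x ((⌈((n : ℝ≥0) + 1) * t.toNNReal⌉₊ : ℝ≥0) / ((n : ℝ≥0) + 1))))) atTop

/-- For fixed `n` the evaluation time lies in a countable grid, so evaluation is jointly measurable
for the product σ-algebra; the limsup preserves this. -/
theorem measurable_expPath : Measurable fun p : (ℝ≥0 → ℝ) × ℝ => expPath p.1 p.2 := by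
  refine Measurable.limsup fun n => ENNReal.measurable_ofReal.comp
    (Real.measurable_exp.comp (Measurable.neg ?_))
  have h : Measurable fun p : (ℝ≥0 → ℝ) × ℕ => p.1 ((p.2 : ℝ≥0) / ((n : ℝ≥0) + 1)) :=
    measurable_from_prod_countable_left fun m =>
      measurable_pi_apply ((m : ℝ≥0) / ((n : ℝ≥0) + 1))
  have hk : Measurable fun p : (ℝ≥0 → ℝ) × ℝ => ⌈((n : ℝ≥0) + 1) * p.2.toNNReal⌉₊ :=
    Nat.measurable_ceil.comp (by fun_prop)
  exact h.comp (measurable_fst.prodMk hk)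

theorem tendsto_ceil_mul_div (t : ℝ≥0) :
    Tendsto (fun n : ℕ => (⌈((n : ℝ≥0) + 1) * t⌉₊ : ℝ≥0) / ((n : ℝ≥0) + 1)) atTop (𝓝[≥] t) := by
  refine tendsto_nhdsWithin_iff.2 ⟨?_, Eventually.of_forall fun n => ?_⟩
  · have h1 : Tendsto (fun n : ℕ => t + 1 / ((n : ℝ≥0) + 1)) atTop (𝓝 (t + 0)) :=
      tendsto_const_nhds.add tendsto_one_div_add_atTop_nhds_zero_nat
    rw [add_zero] at h1
    refine tendsto_of_tendsto_of_tendsto_of_le_of_le tendsto_const_nhds h1 (fun n => ?_) fun n => ?_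
    · dsimp only
      rw [le_div_iff₀ (by positivity), mul_comm]
      exact Nat.le_ceil _
    · dsimp only
      rw [div_le_iff₀ (by positivity), add_mul t, div_mul_cancel₀ _ (by positivity), mul_comm t]
      exact (Nat.ceil_lt_add_one zero_le).le
  · rw [Set.mem_Ici, le_div_iff₀ (by positivity), mul_comm]
    exact Nat.le_ceil _

theorem expPath_eq {x : ℝ≥0 → ℝ} (hx : ∀ t, ContinuousWithinAt x (Set.Ici t) t) (t : ℝ) :
    expPath x t = ENNReal.ofReal (Real.exp (-x t.toNNReal)) :=
  Tendsto.limsup_eq (((ENNReal.continuous_ofReal.comp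
    (Real.continuous_exp.comp continuous_neg)).tendsto _).comp
      ((hx t.toNNReal).tendsto.comp (tendsto_ceil_mul_div _)))

attribute [irreducible] expPath

/-- The path `exp (-x t)`, set to zero from the killing time `z` on. -/
noncomputable def killedPath (x : ℝ≥0 → ℝ) (z : ℝ≥0∞) (t : ℝ) : ℝ≥0∞ :=
  if ENNReal.ofReal t < z then expPath x t else 0

theorem killedPath_of_lt {x : ℝ≥0 → ℝ} {z : ℝ≥0∞} {t : ℝ} (h : ENNReal.ofReal t < z) :
    killedPath x z t = expPath x t :=
  if_pos h

theorem killedPath_of_not_lt {x : ℝ≥0 → ℝ} {z : ℝ≥0∞} {t : ℝ} (h : ¬ ENNReal.ofReal t < z) :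
    killedPath x z t = 0 :=
  if_neg h

theorem measurable_killedPath :
    Measurable fun p : ((ℝ≥0 → ℝ) × ℝ≥0∞) × ℝ => killedPath p.1.1 p.1.2 p.2 := by
  have hs : MeasurableSet {p : ((ℝ≥0 → ℝ) × ℝ≥0∞) × ℝ | ENNReal.ofReal p.2 < p.1.2} :=
    measurableSet_lt (by fun_prop) (by fun_prop)
  have h : Measurable fun p : ((ℝ≥0 → ℝ) × ℝ≥0∞) × ℝ => expPath p.1.1 p.2 :=
    measurable_expPath.comp ((measurable_fst.comp measurable_fst).prodMk measurable_snd)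
  exact Measurable.ite hs h measurable_const

theorem measurable_killedPath_right (x : ℝ≥0 → ℝ) (z : ℝ≥0∞) : Measurable (killedPath x z) :=
  measurable_killedPath.comp (measurable_prodMk_left (x := (x, z)))

/-- The exponential functional of a path on the time interval `[t, z)`. -/
noncomputable def tailFunctional (x : ℝ≥0 → ℝ) (z : ℝ≥0∞) (t : ℝ) : ℝ≥0∞ :=
  ∫⁻ u in Set.Ici t, killedPath x z u

theorem measurable_tailFunctional :
    Measurable fun p : ((ℝ≥0 → ℝ) × ℝ≥0∞) × ℝ => tailFunctional p.1.1 p.1.2 p.2 := by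
  have hs : MeasurableSet {q : (((ℝ≥0 → ℝ) × ℝ≥0∞) × ℝ) × ℝ | q.1.2 ≤ q.2} :=
    measurableSet_le (by fun_prop) (by fun_prop)
  have h : Measurable fun q : (((ℝ≥0 → ℝ) × ℝ≥0∞) × ℝ) × ℝ => killedPath q.1.1.1 q.1.1.2 q.2 :=
    measurable_killedPath.comp
      ((measurable_fst.comp measurable_fst).prodMk measurable_snd)
  have h2 := (h.indicator hs).lintegral_prod_right' (ν := volume)
  have : (fun p : ((ℝ≥0 → ℝ) × ℝ≥0∞) × ℝ => tailFunctional p.1.1 p.1.2 p.2)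
      = fun p => ∫⁻ u, {q : (((ℝ≥0 → ℝ) × ℝ≥0∞) × ℝ) × ℝ | q.1.2 ≤ q.2}.indicator
        (fun q => killedPath q.1.1.1 q.1.1.2 q.2) (p, u) := by
    ext p
    rw [tailFunctional, ← lintegral_indicator measurableSet_Ici]
    rfl
  rw [this]
  exact h2

section Path

variable {x : ℝ≥0 → ℝ}

theorem rightContinuous_killedPath (hx : ∀ t, ContinuousWithinAt x (Set.Ici t) t) (z : ℝ≥0∞)
    (t : ℝ) : ContinuousWithinAt (killedPath x z) (Set.Ici t) t := by
  by_cases h : ENNReal.ofReal t < z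
  · have h1 : ContinuousWithinAt (fun t : ℝ => ENNReal.ofReal (Real.exp (-x t.toNNReal)))
        (Set.Ici t) t := by
      refine (ENNReal.continuous_ofReal.comp
        (Real.continuous_exp.comp continuous_neg)).continuousAt.comp_continuousWithinAt ?_
      exact (hx t.toNNReal).comp continuous_real_toNNReal.continuousWithinAt
        fun s hs => Real.toNNReal_le_toNNReal hs
    refine h1.congr_of_eventuallyEq ?_ (by rw [killedPath_of_lt h, expPath_eq hx])
    have : ∀ᶠ s in 𝓝 t, ENNReal.ofReal s < z :=
      ENNReal.continuous_ofReal.continuousAt.eventually_lt continuousAt_const h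
    filter_upwards [nhdsWithin_le_nhds this] with s hs
    rw [killedPath_of_lt hs, expPath_eq hx]
  · have hz : ∀ s ∈ Set.Ici t, killedPath x z s = 0 := fun s hs =>
      killedPath_of_not_lt fun h' => h ((ENNReal.ofReal_le_ofReal hs).trans_lt h')
    exact continuousWithinAt_const.congr hz (hz t Set.self_mem_Ici)

theorem killedPath_ne_top (hx : ∀ t, ContinuousWithinAt x (Set.Ici t) t) (z : ℝ≥0∞) (t : ℝ) :
    killedPath x z t ≠ ∞ := by
  by_cases h : ENNReal.ofReal t < z
  · rw [killedPath_of_lt h, expPath_eq hx]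
    exact ENNReal.ofReal_ne_top
  · rw [killedPath_of_not_lt h]
    exact ENNReal.zero_ne_top

/-- Factor `exp(-x(t+u)) = exp(-x t) exp(-(x(t+u) - x t))`; what remains is the functional of the
restarted path with residual lifetime `z - t`. This is the form to which the Markov property
applies. -/
theorem tailFunctional_shift (hx : ∀ t, ContinuousWithinAt x (Set.Ici t) t) (z : ℝ≥0∞)
    (t : ℝ≥0) :
    tailFunctional x z t = ENNReal.ofReal (Real.exp (-x t)) *
      tailFunctional (fun s => x (t + s) - x t) (z - t) 0 := by
  have hx' : ∀ s, ContinuousWithinAt (fun s => x (t + s) - x t) (Set.Ici s) s := by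
    intro s
    refine ContinuousWithinAt.sub ?_ continuousWithinAt_const
    exact (hx (t + s)).comp (continuous_const.add continuous_id).continuousWithinAt
      fun u hu => add_le_add_right (Set.mem_Ici.1 hu) t
  have hpre : (fun u : ℝ => (t : ℝ) + u) ⁻¹' Set.Ici (t : ℝ) = Set.Ici 0 := by
    ext u; simp
  rw [tailFunctional, tailFunctional, ← lintegral_const_mul' _ _ ENNReal.ofReal_ne_top,
    ← (measurePreserving_add_left volume (t : ℝ)).setLIntegral_comp_preimage_emb
      (measurableEmbedding_addLeft (t : ℝ)), hpre]
  refine setLIntegral_congr_fun measurableSet_Ici fun u hu => ?_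
  have hu0 : 0 ≤ u := hu
  have hiff : ENNReal.ofReal (t + u) < z ↔ ENNReal.ofReal u < z - t := by
    rw [ENNReal.ofReal_add t.coe_nonneg hu0, ENNReal.ofReal_coe_nnreal, lt_tsub_iff_left]
  by_cases h : ENNReal.ofReal u < z - t
  · rw [killedPath_of_lt h, killedPath_of_lt (hiff.2 h), expPath_eq hx, expPath_eq hx',
      ← ENNReal.ofReal_mul (Real.exp_pos _).le, ← Real.exp_add,
      Real.toNNReal_add t.coe_nonneg hu0, Real.toNNReal_coe]
    congr 2
    ring
  · rw [killedPath_of_not_lt h, killedPath_of_not_lt (mt hiff.1 h), mul_zero]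

theorem tailFunctional_pos (hx : ∀ t, ContinuousWithinAt x (Set.Ici t) t) {z : ℝ≥0∞}
    (hz : 0 < z) : 0 < tailFunctional x z 0 := by
  obtain ⟨r, hr0, hrz⟩ := ENNReal.lt_iff_exists_nnreal_btwn.1 hz
  refine (setLIntegral_pos_iff (measurable_killedPath_right x z)).2 ?_
  have hsub : Set.Ioo (0 : ℝ) r ⊆ Function.support (killedPath x z) ∩ Set.Ici 0 := by
    intro t ht
    refine ⟨?_, ht.1.le⟩
    have : ENNReal.ofReal t < z := by
      refine lt_of_le_of_lt ?_ hrz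
      rw [← ENNReal.ofReal_coe_nnreal]
      exact ENNReal.ofReal_le_ofReal ht.2.le
    rw [Function.mem_support, killedPath_of_lt this, expPath_eq hx]
    exact (ENNReal.ofReal_pos.2 (Real.exp_pos _)).ne'
  refine lt_of_lt_of_le ?_ (measure_mono hsub)
  rw [Real.volume_Ioo, ENNReal.ofReal_pos, sub_zero]
  exact_mod_cast hr0

theorem expFunctional_eq_tailFunctional {Ω : Type*} {ξ : ℝ≥0 → Ω → ℝ} {ζ : Ω → ℝ≥0∞} {ω : Ω}
    (h : ∀ t, ContinuousWithinAt (fun s => ξ s ω) (Set.Ici t) t) :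
    expFunctional ξ ζ ω = tailFunctional (fun s => ξ s ω) (ζ ω) 0 := by
  have hs : MeasurableSet {s : ℝ | 0 ≤ s ∧ ENNReal.ofReal s < ζ ω} :=
    measurableSet_Ici.inter (measurableSet_lt ENNReal.measurable_ofReal measurable_const)
  rw [expFunctional, tailFunctional, ← lintegral_indicator hs,
    ← lintegral_indicator measurableSet_Ici]
  refine lintegral_congr fun t => ?_
  by_cases h0 : 0 ≤ t
  · rw [Set.indicator_of_mem (s := Set.Ici (0 : ℝ)) h0]
    by_cases hz : ENNReal.ofReal t < ζ ω
    · rw [Set.indicator_of_mem (s := {s : ℝ | 0 ≤ s ∧ ENNReal.ofReal s < ζ ω}) ⟨h0, hz⟩,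
        killedPath_of_lt hz, expPath_eq h]
    · rw [Set.indicator_of_notMem (s := {s : ℝ | 0 ≤ s ∧ ENNReal.ofReal s < ζ ω})
        (fun h' => hz h'.2), killedPath_of_not_lt hz]
  · rw [Set.indicator_of_notMem (s := Set.Ici (0 : ℝ)) h0,
      Set.indicator_of_notMem (s := {s : ℝ | 0 ≤ s ∧ ENNReal.ofReal s < ζ ω}) (fun h' => h0 h'.1)]

end Path

/-! ### Laplace exponents and moments of the exponential functional. -/

section KilledSubordinator

variable {Ω : Type*} [MeasurableSpace Ω] {P : Measure Ω} {κ : ℝ≥0}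
  {ξ : ℝ≥0 → Ω → ℝ} {ζ : Ω → ℝ≥0∞} {φ : ℝ → ℝ}

theorem IsKilledSubordinator.ae_rightContinuous (h : IsKilledSubordinator κ ξ ζ P) :
    ∀ᵐ ω ∂P, ∀ t, ContinuousWithinAt (fun s => ξ s ω) (Set.Ici t) t :=
  h.cadlag.mono fun _ hω t => (hω t).1

theorem IsKilledSubordinator.measurable_path (h : IsKilledSubordinator κ ξ ζ P) :
    Measurable fun ω => ((fun s => ξ s ω : ℝ≥0 → ℝ), ζ ω) :=
  (measurable_pi_lambda _ h.measurable).prodMk h.measurable_killing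

theorem IsKilledSubordinator.expFunctional_ae_eq (h : IsKilledSubordinator κ ξ ζ P) :
    expFunctional ξ ζ =ᵐ[P] fun ω => tailFunctional (fun s => ξ s ω) (ζ ω) 0 :=
  h.ae_rightContinuous.mono fun _ hω => expFunctional_eq_tailFunctional hω

theorem measurable_tailFunctional_zero :
    Measurable fun p : (ℝ≥0 → ℝ) × ℝ≥0∞ => tailFunctional p.1 p.2 0 :=
  measurable_tailFunctional.comp measurable_prodMk_right

theorem IsKilledSubordinator.aemeasurable_expFunctional (h : IsKilledSubordinator κ ξ ζ P) :
    AEMeasurable (expFunctional ξ ζ) P :=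
  ⟨_, measurable_tailFunctional_zero.comp h.measurable_path, h.expFunctional_ae_eq⟩

variable [IsProbabilityMeasure P]

theorem IsKilledSubordinator.expFunctional_pos (h : IsKilledSubordinator κ ξ ζ P) :
    ∀ᵐ ω ∂P, 0 < expFunctional ξ ζ ω := by
  have hζ : ∀ᵐ ω ∂P, 0 < ζ ω := by
    have h0 := h.law_killing 0
    rw [NNReal.coe_zero, mul_zero, neg_zero, Real.exp_zero, ENNReal.ofReal_one] at h0
    exact (mem_ae_iff_prob_eq_one (h.measurable_killing measurableSet_Ioi)).2 h0
  filter_upwards [hζ, h.ae_rightContinuous] with ω h1 h2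
  rw [expFunctional_eq_tailFunctional h2]
  exact tailFunctional_pos h2 h1

theorem IsKilledSubordinator.lintegral_laplace (h : IsKilledSubordinator κ ξ ζ P)
    (hφ : IsLaplaceExponent φ ξ ζ P) {u : ℝ} (hu : 0 ≤ u) (t : ℝ≥0) :
    ∫⁻ ω in {ω | (t : ℝ≥0∞) < ζ ω}, ENNReal.ofReal (Real.exp (-(u * ξ t ω))) ∂P
      = ENNReal.ofReal (Real.exp (-(t * φ u))) := by
  rw [← hφ u hu t, ofReal_integral_eq_lintegral_ofReal _ (ae_of_all _ fun _ => (Real.exp_pos _).le)]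
  have hm := h.measurable t
  refine Integrable.of_bound (by fun_prop) 1 (ae_restrict_of_ae ?_)
  filter_upwards [h.nonneg] with ω hω
  rw [Real.norm_eq_abs, abs_of_pos (Real.exp_pos _), Real.exp_le_one_iff, neg_nonpos]
  exact mul_nonneg hu (hω t)

theorem IsKilledSubordinator.laplaceExponent_mono (h : IsKilledSubordinator κ ξ ζ P)
    (hφ : IsLaplaceExponent φ ξ ζ P) {u v : ℝ} (hu : 0 ≤ u) (huv : u ≤ v) : φ u ≤ φ v := by
  have h1 := h.lintegral_laplace hφ hu 1
  have h2 := h.lintegral_laplace hφ (hu.trans huv) 1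
  have h3 : ENNReal.ofReal (Real.exp (-(((1 : ℝ≥0) : ℝ) * φ v)))
      ≤ ENNReal.ofReal (Real.exp (-(((1 : ℝ≥0) : ℝ) * φ u))) := by
    rw [← h1, ← h2]
    refine lintegral_mono_ae (ae_restrict_of_ae ?_)
    filter_upwards [h.nonneg] with ω hω
    gcongr
    exact hω 1
  rw [ENNReal.ofReal_le_ofReal_iff (Real.exp_pos _).le, Real.exp_le_exp] at h3
  simpa using h3

theorem IsKilledSubordinator.laplaceExponent_nonneg (h : IsKilledSubordinator κ ξ ζ P)
    (hφ : IsLaplaceExponent φ ξ ζ P) {u : ℝ} (hu : 0 ≤ u) : 0 ≤ φ u := by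
  have h1 := h.lintegral_laplace hφ hu 1
  have h3 : ENNReal.ofReal (Real.exp (-(((1 : ℝ≥0) : ℝ) * φ u))) ≤ 1 := by
    rw [← h1]
    calc _ ≤ ∫⁻ _ in {ω | ((1 : ℝ≥0) : ℝ≥0∞) < ζ ω}, 1 ∂P := by
          refine lintegral_mono_ae (ae_restrict_of_ae ?_)
          filter_upwards [h.nonneg] with ω hω
          rw [ENNReal.ofReal_le_one, Real.exp_le_one_iff, neg_nonpos]
          exact mul_nonneg hu (hω 1)
      _ ≤ 1 := by
          rw [setLIntegral_one]
          exact prob_le_one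
  rw [ENNReal.ofReal_le_one, Real.exp_le_one_iff] at h3
  simpa using h3

/-- A Laplace exponent that vanishes at one positive point vanishes on `[0, ∞)`. -/
theorem IsKilledSubordinator.laplaceExponent_pos (h : IsKilledSubordinator κ ξ ζ P)
    (hφ : IsLaplaceExponent φ ξ ζ P) (hφ0 : ∃ u : ℝ, 0 ≤ u ∧ φ u ≠ 0) {s : ℝ} (hs : 0 < s) :
    0 < φ s := by
  refine (h.laplaceExponent_nonneg hφ hs.le).lt_of_ne' fun h0 => ?_
  obtain ⟨u, hu, hu0⟩ := hφ0
  set B : Set Ω := {ω | ((1 : ℝ≥0) : ℝ≥0∞) < ζ ω} with hB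
  have hBm : MeasurableSet B := h.measurable_killing measurableSet_Ioi
  have hm := h.measurable 1
  set F : Ω → ℝ≥0∞ := B.indicator fun ω => ENNReal.ofReal (Real.exp (-(s * ξ 1 ω))) with hF
  have hFm : Measurable F := Measurable.indicator (by fun_prop) hBm
  have hFle : F ≤ᵐ[P] fun _ => 1 := by
    filter_upwards [h.nonneg] with ω hω
    refine (Set.indicator_le_self _ _ ω).trans ?_
    rw [ENNReal.ofReal_le_one, Real.exp_le_one_iff, neg_nonpos]
    exact mul_nonneg hs.le (hω 1)
  have h1 := h.lintegral_laplace hφ hs.le 1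
  rw [h0, mul_zero, neg_zero, Real.exp_zero, ENNReal.ofReal_one, ← lintegral_indicator hBm] at h1
  -- `F ≤ 1` has integral `1`, so almost surely `ξ 1 = 0` and there is no killing up to time `1`.
  -- This forces `φ u = 0` for every `u ≥ 0`.
  have hF1 : F =ᵐ[P] fun _ => 1 := by
    refine ae_eq_of_ae_le_of_lintegral_le hFle ?_ aemeasurable_const ?_
    · rw [h1]; exact ENNReal.one_ne_top
    · rw [h1]; simp
  have h2 := h.lintegral_laplace hφ hu 1
  have : ∫⁻ ω in B, ENNReal.ofReal (Real.exp (-(u * ξ 1 ω))) ∂P = 1 := by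
    rw [← lintegral_indicator hBm, ← measure_univ (μ := P), ← lintegral_one]
    refine lintegral_congr_ae ?_
    filter_upwards [hF1] with ω hω
    by_cases hωB : ω ∈ B
    · rw [hF, Set.indicator_of_mem hωB, ENNReal.ofReal_eq_one, Real.exp_eq_one_iff, neg_eq_zero,
        mul_eq_zero, or_iff_right hs.ne'] at hω
      rw [Set.indicator_of_mem hωB, hω]
      simp
    · rw [hF, Set.indicator_of_notMem hωB] at hω
      exact absurd hω zero_ne_one
  rw [this, eq_comm, ENNReal.ofReal_eq_one, Real.exp_eq_one_iff] at h2
  simp only [NNReal.coe_one, one_mul, neg_eq_zero] at h2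
  exact hu0 h2

theorem lintegral_exp_neg_mul_Ici {a : ℝ} (ha : 0 < a) :
    ∫⁻ t in Set.Ici (0 : ℝ), ENNReal.ofReal (Real.exp (-(t * a))) = ENNReal.ofReal a⁻¹ := by
  have h1 : IntegrableOn (fun t : ℝ => Real.exp (-(t * a))) (Set.Ici 0) := by
    rw [integrableOn_Ici_iff_integrableOn_Ioi]
    simpa [mul_comm] using exp_neg_integrableOn_Ioi 0 ha
  rw [← ofReal_integral_eq_lintegral_ofReal h1 (ae_of_all _ fun _ => (Real.exp_pos _).le),
    integral_Ici_eq_integral_Ioi]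
  congr 1
  have := integral_exp_mul_Ioi (a := -a) (by linarith) 0
  simp only [mul_zero, Real.exp_zero] at this
  convert! this using 1
  · congr 1; ext t; congr 1; ring
  · rw [neg_div_neg_eq, one_div]

/-- The expectation of the derivative of `(∫_t^ζ exp (-ξ_u) du) ^ s`. -/
theorem IsKilledSubordinator.lintegral_killedPath_mul_tail_rpow (h : IsKilledSubordinator κ ξ ζ P)
    (hφ : IsLaplaceExponent φ ξ ζ P) {s : ℝ} (hs : 1 ≤ s) {t : ℝ} (ht : 0 ≤ t) :
    ∫⁻ ω, killedPath (fun r => ξ r ω) (ζ ω) t *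
        tailFunctional (fun r => ξ r ω) (ζ ω) t ^ (s - 1) ∂P
      = ENNReal.ofReal (Real.exp (-(t * φ s))) * ∫⁻ ω, expFunctional ξ ζ ω ^ (s - 1) ∂P := by
  lift t to ℝ≥0 using ht
  have hs0 : 0 ≤ s - 1 := by linarith
  have hset : MeasurableSet {ω | (t : ℝ≥0∞) < ζ ω} := h.measurable_killing measurableSet_Ioi
  -- The weight `exp(-s ξ_t)` combines one factor from the integrand and `s - 1` from the power of
  -- the tail.
  have hmk := h.lintegral_markov t (f := fun x => ENNReal.ofReal (Real.exp (-(s * x))))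
    (by fun_prop) (G := fun p => tailFunctional p.1 p.2 0 ^ (s - 1))
    (measurable_tailFunctional_zero.pow_const _)
  rw [h.lintegral_laplace hφ (by linarith) t] at hmk
  have hI : ∫⁻ ω, expFunctional ξ ζ ω ^ (s - 1) ∂P
      = ∫⁻ ω, tailFunctional (fun r => ξ r ω) (ζ ω) 0 ^ (s - 1) ∂P :=
    lintegral_congr_ae (h.expFunctional_ae_eq.mono fun ω hω => by dsimp only; rw [hω])
  rw [hI, ← hmk, ← lintegral_indicator hset]
  refine lintegral_congr_ae ?_
  filter_upwards [h.ae_rightContinuous] with ω hω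
  by_cases hz : (t : ℝ≥0∞) < ζ ω
  · rw [Set.indicator_of_mem (s := {ω | (t : ℝ≥0∞) < ζ ω}) hz,
      killedPath_of_lt (by rwa [ENNReal.ofReal_coe_nnreal]), expPath_eq hω,
      tailFunctional_shift hω, ENNReal.mul_rpow_of_nonneg _ _ hs0, ← mul_assoc]
    congr 1
    rw [Real.toNNReal_coe, ENNReal.ofReal_rpow_of_pos (Real.exp_pos _), ← Real.exp_mul,
      ← ENNReal.ofReal_mul (Real.exp_pos _).le, ← Real.exp_add]
    congr 2
    ring
  · rw [Set.indicator_of_notMem (s := {ω | (t : ℝ≥0∞) < ζ ω}) hz,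
      killedPath_of_not_lt (by rwa [ENNReal.ofReal_coe_nnreal]), zero_mul]

/-- Tonelli, together with `∫₀^∞ exp(-t φ(s)) dt = 1 / φ(s)`. -/
theorem IsKilledSubordinator.lintegral_Ici_killedPath_mul_tail_rpow
    (h : IsKilledSubordinator κ ξ ζ P) (hφ : IsLaplaceExponent φ ξ ζ P) {s : ℝ} (hs : 1 ≤ s)
    (hφs : 0 < φ s) :
    ∫⁻ ω, (∫⁻ t in Set.Ici (0 : ℝ), killedPath (fun r => ξ r ω) (ζ ω) t *
        tailFunctional (fun r => ξ r ω) (ζ ω) t ^ (s - 1)) ∂P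
      = ENNReal.ofReal (φ s)⁻¹ * ∫⁻ ω, expFunctional ξ ζ ω ^ (s - 1) ∂P := by
  have hm : Measurable fun p : ((ℝ≥0 → ℝ) × ℝ≥0∞) × ℝ =>
      killedPath p.1.1 p.1.2 p.2 * tailFunctional p.1.1 p.1.2 p.2 ^ (s - 1) :=
    measurable_killedPath.mul (measurable_tailFunctional.pow_const _)
  have hmap : Measurable fun p : Ω × ℝ => (((fun r => ξ r p.1 : ℝ≥0 → ℝ), ζ p.1), p.2) :=
    (h.measurable_path.comp measurable_fst).prodMk measurable_snd
  rw [lintegral_lintegral_swap (f := fun ω t => killedPath (fun r => ξ r ω) (ζ ω) t *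
      tailFunctional (fun r => ξ r ω) (ζ ω) t ^ (s - 1)) (hm.comp hmap).aemeasurable,
    setLIntegral_congr_fun measurableSet_Ici
      fun t ht => h.lintegral_killedPath_mul_tail_rpow hφ hs ht,
    lintegral_mul_const _ (by fun_prop), lintegral_exp_neg_mul_Ici hφs]

/-- At `s = 1` the tail factor disappears, so no finiteness of `I` is presupposed. The resulting
finite mean supplies the almost sure finiteness that the pathwise identity needs for general `s`. -/
theorem IsKilledSubordinator.lintegral_expFunctional (h : IsKilledSubordinator κ ξ ζ P)
    (hφ : IsLaplaceExponent φ ξ ζ P) (h1 : 0 < φ 1) :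
    ∫⁻ ω, expFunctional ξ ζ ω ∂P = ENNReal.ofReal (φ 1)⁻¹ := by
  have := h.lintegral_Ici_killedPath_mul_tail_rpow hφ le_rfl h1
  simp only [sub_self, ENNReal.rpow_zero, mul_one, lintegral_one, measure_univ] at this
  rw [← this]
  exact lintegral_congr_ae h.expFunctional_ae_eq

theorem IsKilledSubordinator.expFunctional_lt_top (h : IsKilledSubordinator κ ξ ζ P)
    (hφ : IsLaplaceExponent φ ξ ζ P) (h1 : 0 < φ 1) : ∀ᵐ ω ∂P, expFunctional ξ ζ ω < ∞ :=
  ae_lt_top' h.aemeasurable_expFunctional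
    ((h.lintegral_expFunctional hφ h1).trans_ne ENNReal.ofReal_ne_top)

/-- The moment recursion `𝔼[I ^ s] = s / φ(s) * 𝔼[I ^ (s - 1)]`. -/
theorem IsKilledSubordinator.lintegral_expFunctional_rpow (h : IsKilledSubordinator κ ξ ζ P)
    (hφ : IsLaplaceExponent φ ξ ζ P) (h1 : 0 < φ 1) {s : ℝ} (hs : 1 ≤ s) :
    ∫⁻ ω, expFunctional ξ ζ ω ^ s ∂P
      = ENNReal.ofReal (s / φ s) * ∫⁻ ω, expFunctional ξ ζ ω ^ (s - 1) ∂P := by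
  have hφs : 0 < φ s := h1.trans_le (h.laplaceExponent_mono hφ zero_le_one hs)
  rw [div_eq_mul_inv, ENNReal.ofReal_mul (by linarith), mul_assoc,
    ← h.lintegral_Ici_killedPath_mul_tail_rpow hφ hs hφs,
    ← lintegral_const_mul' _ _ ENNReal.ofReal_ne_top]
  refine lintegral_congr_ae ?_
  filter_upwards [h.ae_rightContinuous, h.expFunctional_lt_top hφ h1] with ω hω hfin
  rw [expFunctional_eq_tailFunctional hω] at hfin ⊢
  exact lintegral_Ici_rpow_eq (measurable_killedPath_right _ _) (killedPath_ne_top hω _)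
    (fun t _ => rightContinuous_killedPath hω _ t) hfin.ne hs

/-- Each step of the recursion contributes `k / φ(k) ≤ k / φ(1)` by monotonicity of `φ`. -/
theorem IsKilledSubordinator.lintegral_expFunctional_pow_le (h : IsKilledSubordinator κ ξ ζ P)
    (hφ : IsLaplaceExponent φ ξ ζ P) (h1 : 0 < φ 1) (n : ℕ) :
    ∫⁻ ω, expFunctional ξ ζ ω ^ n ∂P ≤ ENNReal.ofReal (n.factorial * (φ 1)⁻¹ ^ n) := by
  induction n with
  | zero => simp
  | succ n ih =>
    have hrec := h.lintegral_expFunctional_rpow hφ h1 (s := (n + 1 : ℕ))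
      (by push_cast; linarith [n.cast_nonneg (α := ℝ)])
    have hsub : ((n + 1 : ℕ) : ℝ) - 1 = (n : ℕ) := by push_cast; ring
    simp only [hsub, ENNReal.rpow_natCast] at hrec
    rw [hrec]
    have hle : φ 1 ≤ φ ((n + 1 : ℕ) : ℝ) := h.laplaceExponent_mono hφ zero_le_one
      (by push_cast; linarith [n.cast_nonneg (α := ℝ)])
    calc _ ≤ ENNReal.ofReal (((n + 1 : ℕ) : ℝ) * (φ 1)⁻¹) *
          ENNReal.ofReal (n.factorial * (φ 1)⁻¹ ^ n) := by
          refine mul_le_mul' (ENNReal.ofReal_le_ofReal ?_) ih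
          rw [div_eq_mul_inv]
          gcongr
      _ = _ := by
          rw [← ENNReal.ofReal_mul (by positivity), Nat.factorial_succ, pow_succ]
          congr 1
          push_cast
          ring

theorem IsKilledSubordinator.lintegral_expFunctional_rpow_lt_top
    (h : IsKilledSubordinator κ ξ ζ P) (hφ : IsLaplaceExponent φ ξ ζ P) (h1 : 0 < φ 1) {s : ℝ}
    (hs : 0 ≤ s) : ∫⁻ ω, expFunctional ξ ζ ω ^ s ∂P < ∞ := by
  have hle : ∀ x : ℝ≥0∞, x ^ s ≤ 1 + x ^ ⌈s⌉₊ := by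
    intro x
    rcases le_total x 1 with hx | hx
    · exact (ENNReal.rpow_le_one hx hs).trans le_self_add
    · rw [← ENNReal.rpow_natCast]
      exact (ENNReal.rpow_le_rpow_of_exponent_le hx (Nat.le_ceil s)).trans le_add_self
  calc _ ≤ ∫⁻ ω, 1 + expFunctional ξ ζ ω ^ ⌈s⌉₊ ∂P := lintegral_mono fun ω => hle _
    _ = 1 + ∫⁻ ω, expFunctional ξ ζ ω ^ ⌈s⌉₊ ∂P := by
        rw [lintegral_add_left measurable_const, lintegral_one, measure_univ]
    _ < ∞ := ENNReal.add_lt_top.2 ⟨ENNReal.one_lt_top,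
        (h.lintegral_expFunctional_pow_le hφ h1 _).trans_lt ENNReal.ofReal_lt_top⟩

theorem IsKilledSubordinator.lintegral_expFunctional_rpow_pos
    (h : IsKilledSubordinator κ ξ ζ P) (hfin : ∀ᵐ ω ∂P, expFunctional ξ ζ ω < ∞) (s : ℝ) :
    0 < ∫⁻ ω, expFunctional ξ ζ ω ^ s ∂P := by
  refine pos_iff_ne_zero.2 fun h0 => ?_
  rw [lintegral_eq_zero_iff' (h.aemeasurable_expFunctional.pow_const s)] at h0
  have : ∀ᵐ ω ∂P, False := by
    filter_upwards [h0, h.expFunctional_pos, hfin] with ω h2 h3 h4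
    exact (ENNReal.rpow_pos h3 h4.ne).ne' h2
  exact this.exists.choose_spec

end KilledSubordinator

/-! ### Comparison of the two laws. -/

theorem mainTheorem3 {Ω Ω' : Type*} [MeasurableSpace Ω] [MeasurableSpace Ω']
    (P : Measure Ω) [IsProbabilityMeasure P] (Q : Measure Ω') [IsProbabilityMeasure Q]
    (κ κ' : ℝ≥0) (β : ℝ) (hβ : 0 ≤ β) (φ : ℝ → ℝ)
    (ξ : ℝ≥0 → Ω → ℝ) (ζ : Ω → ℝ≥0∞)
    (hξ : IsKilledSubordinator κ ξ ζ P) (hφ : IsLaplaceExponent φ ξ ζ P)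
    (hφ0 : ∃ u : ℝ, 0 ≤ u ∧ φ u ≠ 0)
    (η : ℝ≥0 → Ω' → ℝ) (ζ' : Ω' → ℝ≥0∞)
    (hη : IsKilledSubordinator κ' η ζ' Q) (hTφ : IsLaplaceExponent (transformT β φ) η ζ' Q) :
    AEMeasurable (expFunctional ξ ζ) P ∧ AEMeasurable (expFunctional η ζ') Q ∧
    (∀ᵐ ω ∂P, 0 < expFunctional ξ ζ ω ∧ expFunctional ξ ζ ω < ∞) ∧
    0 < ∫⁻ ω, expFunctional ξ ζ ω ^ β ∂P ∧ ∫⁻ ω, expFunctional ξ ζ ω ^ β ∂P < ∞ ∧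
    Q.map (expFunctional η ζ') =
      (P.map (expFunctional ξ ζ)).withDensity
        (fun x => x ^ β / ∫⁻ ω, expFunctional ξ ζ ω ^ β ∂P) := by
  have hpos : ∀ {s : ℝ}, 0 < s → 0 < φ s := fun hs => hξ.laplaceExponent_pos hφ hφ0 hs
  have h1 : 0 < φ 1 := hpos one_pos
  -- Away from `s = 0` the quotient formula also covers `β = 0`.
  have hT : ∀ {s : ℝ}, 0 < s → transformT β φ s = s / (s + β) * φ (s + β) := by
    intro s hs
    rw [transformT]
    split_ifs with h0
    · rw [h0, add_zero, div_self hs.ne', one_mul]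
    · rfl
  have hT1 : 0 < transformT β φ 1 := by
    rw [hT one_pos]
    exact mul_pos (by positivity) (hpos (by positivity))
  have hfin := hξ.expFunctional_lt_top hφ h1
  have hm0 := hξ.lintegral_expFunctional_rpow_pos hfin β
  have hmt := hξ.lintegral_expFunctional_rpow_lt_top hφ h1 hβ
  have hI := hξ.aemeasurable_expFunctional
  have hJ := hη.aemeasurable_expFunctional
  refine ⟨hI, hJ, hξ.expFunctional_pos.and hfin, hm0, hmt, ?_⟩
  set m : ℝ≥0∞ := ∫⁻ ω, expFunctional ξ ζ ω ^ β ∂P with hm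
  have hdens : Measurable fun x : ℝ≥0∞ => x ^ β / m := by fun_prop
  have hmom : ∀ n : ℕ, ∫⁻ x, x ^ n ∂((P.map (expFunctional ξ ζ)).withDensity fun x => x ^ β / m)
      = m⁻¹ * ∫⁻ ω, expFunctional ξ ζ ω ^ (β + n) ∂P := by
    intro n
    rw [lintegral_withDensity_eq_lintegral_mul _ hdens (by fun_prop),
      lintegral_map' (by fun_prop) hI,
      ← lintegral_const_mul' _ _ (ENNReal.inv_ne_top.2 hm0.ne')]
    refine lintegral_congr fun ω => ?_
    rw [Pi.mul_apply, ENNReal.rpow_add_of_nonneg _ _ hβ n.cast_nonneg, ENNReal.rpow_natCast,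
      div_eq_mul_inv]
    ring
  have hmomJ : ∀ n : ℕ, ∫⁻ ω, expFunctional η ζ' ω ^ n ∂Q
      = m⁻¹ * ∫⁻ ω, expFunctional ξ ζ ω ^ (β + n) ∂P := by
    intro n
    induction n with
    | zero =>
      simp only [pow_zero, lintegral_one, measure_univ, Nat.cast_zero, add_zero]
      exact (ENNReal.inv_mul_cancel hm0.ne' hmt.ne).symm
    | succ n ih =>
      have hn : (0 : ℝ) ≤ n := n.cast_nonneg
      have hs : (0 : ℝ) < n + 1 := by positivity
      have hJrec := hη.lintegral_expFunctional_rpow hTφ hT1 (s := (n + 1 : ℕ))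
        (by push_cast; linarith)
      have hIrec := hξ.lintegral_expFunctional_rpow hφ h1 (s := β + (n + 1 : ℕ))
        (by push_cast; linarith)
      have e1 : ((n + 1 : ℕ) : ℝ) - 1 = (n : ℕ) := by push_cast; ring
      have e2 : β + ((n + 1 : ℕ) : ℝ) - 1 = β + n := by push_cast; ring
      simp only [e1, ENNReal.rpow_natCast] at hJrec
      rw [e2] at hIrec
      rw [hJrec, hIrec, ih, hT (by exact_mod_cast hs)]
      -- The prefactor in `T_β φ` is exactly what turns the recursion factor of `J` at `n + 1` into
      -- that of `I` at `β + n + 1`.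
      have : ((n + 1 : ℕ) : ℝ) / (((n + 1 : ℕ) : ℝ) / (((n + 1 : ℕ) : ℝ) + β) *
          φ (((n + 1 : ℕ) : ℝ) + β)) = (β + (n + 1 : ℕ)) / φ (β + (n + 1 : ℕ)) := by
        have hne : ((n + 1 : ℕ) : ℝ) ≠ 0 := by exact_mod_cast hs.ne'
        have hφne : φ (β + (n + 1 : ℕ)) ≠ 0 := (hpos (by push_cast; linarith)).ne'
        have hne2 : β + ((n + 1 : ℕ) : ℝ) ≠ 0 := by push_cast; linarith
        rw [add_comm _ β]
        field_simp
      rw [this]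
      ring
  have hmapJ : ∀ n : ℕ, ∫⁻ x, x ^ n ∂(Q.map (expFunctional η ζ'))
      = ∫⁻ ω, expFunctional η ζ' ω ^ n ∂Q := fun n => lintegral_map' (by fun_prop) hJ
  have hprobJ : IsProbabilityMeasure (Q.map (expFunctional η ζ')) :=
    Measure.isProbabilityMeasure_map hJ
  have heq : ∀ n : ℕ, ∫⁻ x, x ^ n ∂(Q.map (expFunctional η ζ'))
      = ∫⁻ x, x ^ n ∂((P.map (expFunctional ξ ζ)).withDensity fun x => x ^ β / m) :=
    fun n => by rw [hmapJ, hmomJ, hmom]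
  have hprob : IsProbabilityMeasure
      ((P.map (expFunctional ξ ζ)).withDensity fun x => x ^ β / m) := by
    refine ⟨?_⟩
    have := heq 0
    simp only [pow_zero, lintegral_one, measure_univ] at this
    exact this.symm
  -- The factorial bound, with `c = 1 / T_β φ(1)`, is needed only for the law of `J`; equality of
  -- moments transfers it to the other measure.
  exact ext_of_lintegral_pow_eq heq (inv_nonneg.2 hT1.le) fun n =>
    (hmapJ n).le.trans (hη.lintegral_expFunctional_pow_le hTφ hT1 n)
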